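/- Let $\mathcal{L}$ denote the family of all Hausdorff topologies $\tau$ on the set $\mathbb{R}$ that are coarser than (i.e. contained in) the Euclidean topology. Let $\mathfrak{c} = |\mathbb{R}|$. For every infinite cardinal number $\kappa \le \mathfrak{c}$ there exists a family $\mathcal{T} \subset \mathcal{L}$ with $|\mathcal{T}| = 2^{\kappa}$ such that, for every $\tau \in \mathcal{T}$, the space $(\mathbb{R},\tau)$ is completely normal (any two sets $A, B$ with $\overline{A} \cap B = A \cap \overline{B} = \emptyset$ are contained in disjoint open sets), is of first category (a countable union of nowhere dense subsets of itself), and has weight $\kappa$ (the least cardinality of a basis of the topology is $\kappa$), and such that $(\mathbb{R},\tau)$ and $(\mathbb{R},\tau')$ are not homeomorphic for any two distinct $\tau, \tau' \in \mathcal{T}$. -/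

import Mathlib

open Topology Cardinal

/-- The Euclidean topology on `ℝ`, named so that it cannot be confused with another topology
`τ` on `ℝ` that is in scope. -/
abbrev euclideanTopology : TopologicalSpace ℝ := inferInstance

/-- The family of all Hausdorff topologies on `ℝ` that are coarser than (contained in) the
Euclidean topology. -/
def coarseHausdorffTopologies : Set (TopologicalSpace ℝ) :=
  {τ | (∀ U : Set ℝ, IsOpen[τ] U → IsOpen[euclideanTopology] U) ∧ @T2Space ℝ τ}

/-- The weight of a topological space: the least cardinality of a basis of its topology. -/
noncomputable def topologicalWeight {X : Type*} (τ : TopologicalSpace X) : Cardinal :=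
  sInf {μ | ∃ B : Set (Set X), @TopologicalSpace.IsTopologicalBasis X τ B ∧ #B = μ}

/-- A space is of first category if it is a countable union of nowhere dense subsets of itself
(equivalently, a meagre subset of itself). -/
def IsFirstCategorySpace {X : Type*} (τ : TopologicalSpace X) : Prop :=
  ∃ A : ℕ → Set X, (∀ n, @IsNowhereDense X τ (A n)) ∧ ⋃ n, A n = Set.univ

open MeasureTheory Filter

/-! Choose reals `v j` that together with 1 are rationally independent, and give the line the
topology induced by t ↦ ((v j · t mod 1) for j ∈ S, w t), where w is 0 on the negative half-line and
a 1-periodic function f on the other. This map is Euclidean-continuous and, with two frequencies,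
injective. So the topology is coarser, regular and Hausdorff, and it is completely normal because
the Euclidean line is hereditarily Lindelöf (`t5Space_of_le`). Kronecker's theorem gives the rest:
nonempty open sets reach arbitrarily far right, so compact intervals are nowhere dense; far to the
left, finitely many conditions leave the other coordinates free, so the weight is |S| for infinite
S.

Non-homeomorphic members are found in two ways. If 2^κ > 𝔠, vary S: at most 𝔠 of the topologies lie
in one homeomorphism class (`exists_subset_pairwise_not_homeomorphic`). If 2^κ = 𝔠, vary f: a
homeomorphism is Euclidean-continuous (`continuous_of_continuous_lineTopology`), hence monotone. It
must be increasing and preserve the zeros of w, which are the accumulation points of the negative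
end (`exists_orderIso_of_homeomorph`). For f = `gapFunction D`, the order type of this zero set
determines D (`eq_of_orderIso`). -/

/-- The average of `f` along the linear flow with velocity `u` over the times `[T, T + N]`. -/
noncomputable def flowAverage {ι : Type*} [Fintype ι] (u : ι → ℝ) (T : ℝ)
    (f : C(UnitAddTorus ι, ℂ)) (N : ℕ) : ℂ :=
  (N : ℂ)⁻¹ * ∫ t in T..(T + N), f (fun i => ((u i * t : ℝ) : UnitAddCircle))

/-! ### Kronecker's theorem by equidistribution of linear flows -/

section Kronecker

variable {ι : Type*} [Fintype ι] {u : ι → ℝ}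

lemma continuous_flow_comp {ι : Type*} (u : ι → ℝ) (f : C(UnitAddTorus ι, ℂ)) :
    Continuous fun t : ℝ => f (fun i => ((u i * t : ℝ) : UnitAddCircle)) := by
  refine f.continuous.comp (continuous_pi fun i => ?_)
  exact (AddCircle.continuous_mk' 1).comp (by fun_prop)

lemma norm_flowAverage_le (u : ι → ℝ) (T : ℝ) (f : C(UnitAddTorus ι, ℂ)) (N : ℕ) :
    ‖flowAverage u T f N‖ ≤ ‖f‖ := by
  rw [flowAverage, norm_mul, norm_inv, Complex.norm_natCast]
  have h : ‖∫ t in T..(T + N), f (fun i => ((u i * t : ℝ) : UnitAddCircle))‖ ≤ ‖f‖ * N := by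
    have := intervalIntegral.norm_integral_le_of_norm_le_const (a := T) (b := T + N) (C := ‖f‖)
      (f := fun t => f (fun i => ((u i * t : ℝ) : UnitAddCircle)))
      (fun t _ => f.norm_coe_le_norm _)
    simpa using this
  rcases N.eq_zero_or_pos with rfl | hN
  · simp
  · have : (0 : ℝ) < N := by exact_mod_cast hN
    rw [inv_mul_le_iff₀ this, mul_comm]
    exact h

lemma flowAverage_add (u : ι → ℝ) (T : ℝ) (f g : C(UnitAddTorus ι, ℂ)) (N : ℕ) :
    flowAverage u T (f + g) N = flowAverage u T f N + flowAverage u T g N := by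
  simp only [flowAverage, ContinuousMap.add_apply]
  rw [intervalIntegral.integral_add ((continuous_flow_comp u f).intervalIntegrable _ _)
    ((continuous_flow_comp u g).intervalIntegrable _ _), mul_add]

lemma flowAverage_smul (u : ι → ℝ) (T : ℝ) (c : ℂ) (f : C(UnitAddTorus ι, ℂ)) (N : ℕ) :
    flowAverage u T (c • f) N = c * flowAverage u T f N := by
  simp only [flowAverage, ContinuousMap.smul_apply, smul_eq_mul]
  rw [intervalIntegral.integral_const_mul]
  ring

lemma mFourier_flow (u : ι → ℝ) (n : ι → ℤ) (t : ℝ) :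
    UnitAddTorus.mFourier n (fun i => ((u i * t : ℝ) : UnitAddCircle)) =
      Complex.exp (2 * Real.pi * Complex.I * (∑ i, n i * u i : ℝ) * t) := by
  simp only [UnitAddTorus.mFourier, ContinuousMap.coe_mk, fourier_coe_apply]
  rw [← Complex.exp_sum]
  congr 1
  push_cast
  rw [Finset.mul_sum, Finset.sum_mul]
  refine Finset.sum_congr rfl fun i _ => ?_
  ring

lemma intCombination_ne_zero (hu : LinearIndependent ℚ u) {n : ι → ℤ} (hn : n ≠ 0) :
    (∑ i, n i * u i : ℝ) ≠ 0 := by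
  intro h
  apply hn
  rw [Fintype.linearIndependent_iff] at hu
  have := hu (fun i => (n i : ℚ)) (by simpa [Rat.smul_def] using h)
  funext i
  exact_mod_cast this i

/-- Along the flow the character is exp(ct) with c ≠ 0 imaginary, whose primitive is bounded; the
average is O(1/N). -/
lemma tendsto_flowAverage_mFourier (hu : LinearIndependent ℚ u) (T : ℝ) {n : ι → ℤ}
    (hn : n ≠ 0) :
    Tendsto (flowAverage u T (UnitAddTorus.mFourier n)) atTop (𝓝 0) := by
  set l : ℝ := ∑ i, n i * u i with hl
  have hl0 : l ≠ 0 := intCombination_ne_zero hu hn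
  set c : ℂ := 2 * Real.pi * Complex.I * l with hc
  have hc0 : c ≠ 0 := by
    simp [hc, hl0, Real.pi_ne_zero]
  have hexp : ∀ t : ℝ, ‖Complex.exp (c * t)‖ = 1 := by
    intro t
    rw [Complex.norm_exp]
    simp [hc]
  have hb : ∀ N : ℕ, ‖flowAverage u T (UnitAddTorus.mFourier n) N‖ ≤ (2 / ‖c‖) * (N : ℝ)⁻¹ := by
    intro N
    simp only [flowAverage, mFourier_flow]
    rw [integral_exp_mul_complex hc0, norm_mul, norm_inv, Complex.norm_natCast, norm_div, mul_comm]
    gcongr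
    refine (norm_sub_le _ _).trans ?_
    rw [hexp, hexp]
    norm_num
  refine squeeze_zero_norm hb ?_
  simpa using (tendsto_inv_atTop_nhds_zero_nat (𝕜 := ℝ)).const_mul (2 / ‖c‖)

/-- The normalised Haar measure of the torus. -/
noncomputable def torusMeasure (ι : Type*) [Fintype ι] : Measure (UnitAddTorus ι) :=
  Measure.pi fun _ => AddCircle.haarAddCircle (T := 1)

instance : IsProbabilityMeasure (torusMeasure ι) := by
  unfold torusMeasure; infer_instance

instance : (torusMeasure ι).IsOpenPosMeasure := by
  unfold torusMeasure; infer_instance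

/-- The integral factors over coordinates, and a half-period shift negates a factor with nonzero
index. -/
lemma integral_mFourier {n : ι → ℤ} (hn : n ≠ 0) :
    ∫ x, UnitAddTorus.mFourier n x ∂(torusMeasure ι) = 0 := by
  simp only [UnitAddTorus.mFourier, ContinuousMap.coe_mk, torusMeasure]
  rw [MeasureTheory.integral_fintype_prod_eq_prod
    (f := fun i (x : UnitAddCircle) => (fourier (n i) x : ℂ))]
  obtain ⟨i, hi⟩ := Function.ne_iff.mp hn
  refine Finset.prod_eq_zero (Finset.mem_univ i) ?_
  exact integral_eq_zero_of_add_right_eq_neg (μ := AddCircle.haarAddCircle)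
    (fourier_add_half_inv_index hi (by norm_num))

lemma tendsto_flowAverage_of_mem_span (hu : LinearIndependent ℚ u) (T : ℝ)
    {f : C(UnitAddTorus ι, ℂ)}
    (hf : f ∈ Submodule.span ℂ (Set.range (UnitAddTorus.mFourier (d := ι)))) :
    Tendsto (flowAverage u T f) atTop (𝓝 (∫ x, f x ∂(torusMeasure ι))) := by
  have hint : ∀ g : C(UnitAddTorus ι, ℂ), Integrable g (torusMeasure ι) := fun g =>
    g.continuous.integrable_of_hasCompactSupport (HasCompactSupport.of_compactSpace g)
  induction hf using Submodule.span_induction with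
  | mem x hx =>
    obtain ⟨n, rfl⟩ := hx
    by_cases hn : n = 0
    · subst hn
      rw [UnitAddTorus.mFourier_zero]
      have h1 : ∀ᶠ N : ℕ in atTop, (1 : ℂ) = flowAverage u T 1 N := by
        filter_upwards [eventually_gt_atTop 0] with N hN
        have : (N : ℂ) ≠ 0 := by exact_mod_cast hN.ne'
        simp [flowAverage, this]
      simpa using tendsto_const_nhds.congr' h1
    · rw [integral_mFourier hn]
      exact tendsto_flowAverage_mFourier hu T hn
  | zero =>
    have : flowAverage u T 0 = fun _ => 0 := by
      funext N; simp [flowAverage]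
    simp [this]
  | add f g _ _ hf hg =>
    have : flowAverage u T (f + g) = fun N => flowAverage u T f N + flowAverage u T g N := by
      funext N; exact flowAverage_add u T f g N
    simp only [this, ContinuousMap.add_apply]
    rw [integral_add (hint f) (hint g)]
    exact hf.add hg
  | smul c f _ hf =>
    have : flowAverage u T (c • f) = fun N => c * flowAverage u T f N := by
      funext N; exact flowAverage_smul u T c f N
    simp only [this, ContinuousMap.smul_apply, smul_eq_mul]
    rw [integral_const_mul]
    exact hf.const_mul c

/-- Kronecker's approximation theorem, in the torus. -/
lemma exists_flow_mem_of_isOpen (hu : LinearIndependent ℚ u) (T : ℝ)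
    {V : Set (UnitAddTorus ι)} (hV : IsOpen V) (hne : V.Nonempty) :
    ∃ t, T ≤ t ∧ (fun i => ((u i * t : ℝ) : UnitAddCircle)) ∈ V := by
  by_contra! hcon
  obtain ⟨b, hb⟩ := hne
  -- A bump vanishing off `V` has positive integral, yet its averages along a flow avoiding `V` are
  -- zero.
  obtain ⟨f, hf0, hf1, hf⟩ := exists_continuous_zero_one_of_isClosed
    (s := Vᶜ) (t := {b}) hV.isClosed_compl isClosed_singleton (by simpa using hb)
  have hfi : Integrable f (torusMeasure ι) :=
    f.continuous.integrable_of_hasCompactSupport (HasCompactSupport.of_compactSpace f)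
  have hpos : 0 < ∫ x, f x ∂(torusMeasure ι) := by
    refine (Continuous.integral_pos_of_hasCompactSupport_nonneg_nonzero (x := b) f.continuous
      (HasCompactSupport.of_compactSpace f) (fun x => (hf x).1) ?_)
    rw [hf1 (Set.mem_singleton b)]
    simp
  set g : C(UnitAddTorus ι, ℂ) := ⟨fun x => (f x : ℂ), by fun_prop⟩ with hg
  have hgi : ∫ x, g x ∂(torusMeasure ι) = ((∫ x, f x ∂(torusMeasure ι) : ℝ) : ℂ) := by
    simp only [hg, ContinuousMap.coe_mk]
    exact integral_ofReal
  set m : ℝ := ∫ x, f x ∂(torusMeasure ι) with hm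
  have hg0 : ∀ N, flowAverage u T g N = 0 := by
    intro N
    rw [flowAverage]
    have : ∫ t in T..(T + N), g (fun i => ((u i * t : ℝ) : UnitAddCircle)) =
        ∫ t in T..(T + N), (0 : ℂ) := by
      refine intervalIntegral.integral_congr fun t ht => ?_
      rw [Set.uIcc_of_le (by simp)] at ht
      have := hf0 (hcon t ht.1)
      simp only [Pi.zero_apply] at this
      simp [hg, this]
    rw [this]; simp
  have hgc : g ∈ closure (Submodule.span ℂ (Set.range (UnitAddTorus.mFourier (d := ι))) :
      Set C(UnitAddTorus ι, ℂ)) := by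
    have := UnitAddTorus.span_mFourier_closure_eq_top (d := ι)
    rw [← Submodule.topologicalClosure_coe, this]
    trivial
  -- `‖g - p‖` bounds both the integral of `p` and its distance to the integral of `g`, so m ≤ 2‖g -
  -- p‖ < m.
  obtain ⟨p, hp, hgp⟩ := Metric.mem_closure_iff.mp hgc (m / 2) (by positivity)
  rw [dist_eq_norm] at hgp
  have hlim := tendsto_flowAverage_of_mem_span hu T hp
  have hpn : ∀ N, ‖flowAverage u T p N‖ ≤ ‖g - p‖ := by
    intro N
    have h := flowAverage_add u T p (g - p) N
    rw [add_sub_cancel, hg0] at h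
    rw [eq_neg_of_add_eq_zero_left h.symm, norm_neg]
    exact norm_flowAverage_le u T _ N
  have h1 : ‖∫ x, p x ∂(torusMeasure ι)‖ ≤ ‖g - p‖ :=
    le_of_tendsto hlim.norm (Eventually.of_forall hpn)
  have hint : ∀ g : C(UnitAddTorus ι, ℂ), Integrable g (torusMeasure ι) := fun g =>
    g.continuous.integrable_of_hasCompactSupport (HasCompactSupport.of_compactSpace g)
  have h2 : ‖∫ x, g x ∂(torusMeasure ι) - ∫ x, p x ∂(torusMeasure ι)‖ ≤ ‖g - p‖ := by
    rw [← integral_sub (hint g) (hint p)]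
    have := norm_integral_le_of_norm_le_const (μ := torusMeasure ι) (f := fun x => g x - p x)
      (C := ‖g - p‖) (Eventually.of_forall fun x => (g - p).norm_coe_le_norm x)
    simpa using this
  have h3 : ‖∫ x, g x ∂(torusMeasure ι)‖ = m := by
    rw [hgi, Complex.norm_real, Real.norm_of_nonneg hpos.le]
  have h4 := norm_sub_norm_le (∫ x, g x ∂(torusMeasure ι)) (∫ x, p x ∂(torusMeasure ι))
  linarith

end Kronecker

/-- Kronecker's approximation theorem: the multiples `u i * t` of finitely many rationally
independent reals approximate arbitrary targets modulo one, for arbitrarily large `t`. -/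
lemma kronecker_atTop {ι : Type*} {u : ι → ℝ} (hu : LinearIndependent ℚ u) (F : Finset ι)
    {O : ι → Set UnitAddCircle} {β : ι → UnitAddCircle} (hO : ∀ i ∈ F, O i ∈ 𝓝 (β i)) (T : ℝ) :
    ∃ t, T ≤ t ∧ ∀ i ∈ F, ((u i * t : ℝ) : UnitAddCircle) ∈ O i := by
  have hF : LinearIndependent ℚ (fun i : F => u i) := hu.comp _ Subtype.val_injective
  obtain ⟨t, hT, ht⟩ := exists_flow_mem_of_isOpen hF T
    (V := Set.univ.pi fun i : F => interior (O i))
    (isOpen_set_pi Set.finite_univ fun i _ => isOpen_interior)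
    ⟨fun i => β i, fun i _ => mem_interior_iff_mem_nhds.mpr (hO i i.2)⟩
  exact ⟨t, hT, fun i hi => interior_subset (ht ⟨i, hi⟩ trivial)⟩

lemma kronecker_atBot {ι : Type*} {u : ι → ℝ} (hu : LinearIndependent ℚ u) (F : Finset ι)
    {O : ι → Set UnitAddCircle} {β : ι → UnitAddCircle} (hO : ∀ i ∈ F, O i ∈ 𝓝 (β i)) (T : ℝ) :
    ∃ t, t ≤ T ∧ ∀ i ∈ F, ((u i * t : ℝ) : UnitAddCircle) ∈ O i := by
  have hneg : LinearIndependent ℚ (fun i => -u i) := by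
    have h := hu.units_smul (fun _ : ι => (-1 : ℚˣ))
    have e : (fun _ : ι => (-1 : ℚˣ)) • u = fun i => -u i := by
      funext i
      simp [Units.smul_def]
    rwa [e] at h
  obtain ⟨t, hT, ht⟩ := kronecker_atTop hneg F hO (-T)
  refine ⟨-t, by linarith, fun i hi => ?_⟩
  have := ht i hi
  rwa [neg_mul, ← mul_neg] at this

/-! ### The induced topologies and their separation properties -/

/-- The function which is `f` modulo one on `[0, ∞)` and vanishes on `(-∞, 0)`. -/
noncomputable def rightPart (f : C(UnitAddCircle, ℝ)) (t : ℝ) : ℝ :=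
  if 0 ≤ t then f (t : UnitAddCircle) else 0

lemma continuous_rightPart {f : C(UnitAddCircle, ℝ)} (hf : f 0 = 0) :
    Continuous (rightPart f) := by
  unfold rightPart
  refine Continuous.if_le (f.continuous.comp (AddCircle.continuous_mk' 1)) continuous_const
    continuous_const continuous_id ?_
  rintro x rfl
  simpa using hf

lemma rightPart_of_nonneg (f : C(UnitAddCircle, ℝ)) {t : ℝ} (ht : 0 ≤ t) :
    rightPart f t = f (t : UnitAddCircle) := if_pos ht

lemma rightPart_of_neg (f : C(UnitAddCircle, ℝ)) {t : ℝ} (ht : t < 0) :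
    rightPart f t = 0 := if_neg ht.not_ge

/-- The map sending `t` to the point of the torus with coordinates `v j * t`, `j ∈ S`, together
with the real number `w t`. -/
noncomputable def lineMap {J : Type*} (v : J → ℝ) (S : Set J) (w : ℝ → ℝ) (t : ℝ) :
    (S → UnitAddCircle) × ℝ :=
  (fun j => ((v j * t : ℝ) : UnitAddCircle), w t)

/-- The topology on the line induced by `lineMap`. -/
noncomputable abbrev lineTopology {J : Type*} (v : J → ℝ) (S : Set J) (w : ℝ → ℝ) :
    TopologicalSpace ℝ :=
  TopologicalSpace.induced (lineMap v S w) instTopologicalSpaceProd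

lemma continuous_comp_induced {X Y Z : Type*} [tY : TopologicalSpace Y] [tZ : TopologicalSpace Z]
    (f : X → Y) {g : Y → Z} (hg : Continuous g) :
    Continuous[TopologicalSpace.induced f tY, tZ] (g ∘ f) := by
  let _ := TopologicalSpace.induced f tY
  exact hg.comp continuous_induced_dom

lemma t3Space_induced {X Y : Type*} [tY : TopologicalSpace Y] [T3Space Y] {f : X → Y}
    (hf : Function.Injective f) : @T3Space X (TopologicalSpace.induced f tY) := by
  let _ := TopologicalSpace.induced f tY
  exact (Topology.IsEmbedding.mk ⟨rfl⟩ hf).t3Space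

section Line

variable {J : Type*} {v : J → ℝ} {S : Set J} {w : ℝ → ℝ}

lemma continuous_mul_coe (a : ℝ) : Continuous fun t : ℝ => ((a * t : ℝ) : UnitAddCircle) :=
  (AddCircle.continuous_mk' 1).comp (by fun_prop)

lemma continuous_lineMap (hw : Continuous w) : Continuous (lineMap v S w) :=
  Continuous.prodMk (f := fun t => fun j : S => ((v j * t : ℝ) : UnitAddCircle))
    (continuous_pi fun j => continuous_mul_coe (v j)) hw

lemma isOpen_of_lineTopology (hw : Continuous w) {U : Set ℝ} (hU : IsOpen[lineTopology v S w] U) :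
    IsOpen U := by
  obtain ⟨V, hV, rfl⟩ := isOpen_induced_iff.mp hU
  exact hV.preimage (continuous_lineMap hw)

lemma lineTopology_continuous_coord {j : J} (hj : j ∈ S) :
    Continuous[lineTopology v S w, inferInstance] fun t : ℝ => ((v j * t : ℝ) : UnitAddCircle) := by
  exact continuous_comp_induced (lineMap v S w)
    ((continuous_apply (⟨j, hj⟩ : S)).comp continuous_fst)

lemma lineTopology_continuous_snd : Continuous[lineTopology v S w, inferInstance] w := by
  exact continuous_comp_induced (lineMap v S w) continuous_snd

lemma mem_nhds_lineTopology {x : ℝ} {U : Set ℝ} (hU : U ∈ @nhds ℝ (lineTopology v S w) x) :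
    ∃ F : Finset J, (F : Set J) ⊆ S ∧ ∃ O : J → Set UnitAddCircle,
      (∀ j, O j ∈ 𝓝 ((v j * x : ℝ) : UnitAddCircle)) ∧ ∃ V ∈ 𝓝 (w x),
        ∀ t, (∀ j ∈ F, ((v j * t : ℝ) : UnitAddCircle) ∈ O j) → w t ∈ V → t ∈ U := by
  classical
  rw [lineTopology, nhds_induced, lineMap, nhds_prod_eq] at hU
  obtain ⟨W, hW, hWU⟩ := hU
  obtain ⟨A, hA, V, hV, hAV⟩ := Filter.mem_prod_iff.mp hW
  rw [nhds_pi, Filter.mem_pi] at hA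
  obtain ⟨I, hI, O, hO, hpi⟩ := hA
  refine ⟨hI.toFinset.map (Function.Embedding.subtype _), by simp,
    fun j => if h : j ∈ S then O ⟨j, h⟩ else Set.univ, fun j => ?_, V, hV, fun t ht htV => ?_⟩
  · by_cases h : j ∈ S
    · simpa only [h, dite_true] using hO ⟨j, h⟩
    · simp [h]
  · refine hWU (hAV ⟨hpi fun j hj => ?_, htV⟩)
    have h := ht j (by simpa using hj)
    simp only [j.2, dite_true] at h
    exact h

/-- The reals `v j` together with `1` are rationally independent. -/
def IndependentWithOne (v : J → ℝ) : Prop :=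
  LinearIndependent ℚ (fun o : Option J => o.elim 1 v)

lemma IndependentWithOne.linearIndependent (hv : IndependentWithOne v) :
    LinearIndependent ℚ v :=
  hv.comp _ (Option.some_injective J)

lemma IndependentWithOne.ne_zero (hv : IndependentWithOne v) (j : J) : v j ≠ 0 :=
  hv.linearIndependent.ne_zero j

/-- Clearing denominators gives a rational relation between `v i` and `v j`. This is why two
coordinates modulo one determine a real number. -/
lemma IndependentWithOne.eq_zero_of_div_eq (hv : IndependentWithOne v) {i j : J} (hij : i ≠ j)
    {m n : ℤ} (h : (m : ℝ) / v i = n / v j) : m = 0 := by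
  have hp := (LinearIndepOn.pair_iff v hij).mp
    ((linearIndepOn_univ_iff.mpr hv.linearIndependent).mono (Set.subset_univ {i, j}))
  have h' : (n : ℝ) * v i = m * v j := by
    have := hv.ne_zero i
    have := hv.ne_zero j
    field_simp at h
    linarith
  have := (hp (n : ℚ) (-m : ℚ) (by simp [Rat.smul_def]; linarith)).2
  simpa using this

lemma exists_int_of_coe_eq_coe {x y : ℝ} (h : (x : UnitAddCircle) = y) :
    ∃ n : ℤ, x - y = n := by
  have h0 : ((x - y : ℝ) : UnitAddCircle) = 0 := by
    rw [AddCircle.coe_sub, h, sub_self]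
  obtain ⟨n, hn⟩ := (AddCircle.coe_eq_zero_iff 1).mp h0
  exact ⟨n, by simpa using hn.symm⟩

lemma eq_of_countable_range {q : ℝ → ℝ} (hq : Continuous q)
    (hc : (Set.range q).Countable) (s t : ℝ) : q s = q t :=
  hc.isTotallyDisconnected _ subset_rfl (isPreconnected_range hq) ⟨s, rfl⟩ ⟨t, rfl⟩

lemma lineMap_injective (hv : IndependentWithOne v) (hS : S.Nontrivial) :
    Function.Injective (lineMap v S w) := by
  intro x y hxy
  obtain ⟨i, hi, j, hj, hij⟩ := hS
  have h1 := congrArg Prod.fst hxy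
  obtain ⟨m, hm⟩ := exists_int_of_coe_eq_coe (congrFun h1 ⟨i, hi⟩)
  obtain ⟨n, hn⟩ := exists_int_of_coe_eq_coe (congrFun h1 ⟨j, hj⟩)
  simp only at hm hn
  have hvi := hv.ne_zero i
  have hvj := hv.ne_zero j
  have : m = 0 := hv.eq_zero_of_div_eq hij (n := n) (by
    rw [← hm, ← hn]; field_simp)
  rw [this, ← mul_sub] at hm
  simpa [hvi, sub_eq_zero] using hm

/-- A map into the line which is continuous for `lineTopology` is continuous for the Euclidean
topology. -/
lemma continuous_of_continuous_lineTopology (hv : IndependentWithOne v) (hS : S.Nontrivial)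
    {g : ℝ → ℝ} (hg : Continuous[inferInstance, lineTopology v S w] g) : Continuous g := by
  -- Each circle coordinate of g lifts through the covering ℝ → ℝ/ℤ to a continuous function
  -- differing from `v j * g` by integers.
  have lift : ∀ j ∈ S, ∃ F : C(ℝ, ℝ), F 0 = v j * g 0 ∧ ∀ s, ∃ n : ℤ, F s - v j * g s = n := by
    intro j hj
    have hc : Continuous fun s => ((v j * g s : ℝ) : UnitAddCircle) := by
      have h := lineTopology_continuous_coord (v := v) (w := w) hj
      exact @Continuous.comp ℝ ℝ UnitAddCircle _ (lineTopology v S w) _ g _ h hg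
    obtain ⟨F, ⟨hF0, hF⟩, -⟩ := (AddCircle.isCoveringMap_coe (1 : ℝ)).existsUnique_continuousMap_lifts
      ⟨_, hc⟩ (0 : ℝ) (v j * g 0) rfl
    exact ⟨F, hF0, fun s => exists_int_of_coe_eq_coe (congrFun hF s)⟩
  obtain ⟨i, hi, j, hj, hij⟩ := hS
  obtain ⟨F, hF0, hF⟩ := lift i hi
  obtain ⟨G, hG0, hG⟩ := lift j hj
  have hvi := hv.ne_zero i
  have hvj := hv.ne_zero j
  choose m hm using hF
  choose n hn using hG
  have hq : ∀ s, F s / v i - G s / v j = m s / v i - n s / v j := by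
    intro s
    rw [← hm, ← hn]
    field_simp
    ring
  -- The two lifts, rescaled, differ by a continuous function with countable range, hence by a
  -- constant, which is 0 by the normalisation at 0; independence then kills the integer errors.
  have hcount : (Set.range fun s => F s / v i - G s / v j).Countable := by
    refine (Set.countable_range fun p : ℤ × ℤ => (p.1 : ℝ) / v i - p.2 / v j).mono ?_
    rintro _ ⟨s, rfl⟩
    exact ⟨(m s, n s), (hq s).symm⟩
  have hconst : ∀ s, F s / v i - G s / v j = 0 := by
    intro s
    rw [eq_of_countable_range (q := fun s => F s / v i - G s / v j) (by fun_prop) hcount s 0,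
      hF0, hG0]
    field_simp
    ring
  have hgF : g = fun s => F s / v i := by
    funext s
    have h0 : m s = 0 := hv.eq_zero_of_div_eq hij (n := n s) (by
      have := hq s
      rw [hconst] at this
      linarith)
    have := hm s
    rw [h0] at this
    field_simp
    push_cast at this
    linarith
  rw [hgF]
  fun_prop

/-- A regular Hausdorff topology coarser than a hereditarily Lindelöf one is completely normal. -/
lemma t5Space_of_le {X : Type*} {t s : TopologicalSpace X} (hts : t ≤ s)
    (ht : @HereditarilyLindelofSpace X t) (hs : @T3Space X s) : @T5Space X s := by
  have : CompletelyNormalSpace X := by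
    -- Every subspace is Lindelöf, as an image under the identity, and regular, hence normal.
    refine CompletelyNormalSpace.of_forall_normalSpace fun A => ?_
    have hA : IsLindelof A := by
      have h1 : @IsLindelof X t A := @HereditarilyLindelofSpace.isLindelof X t ht A
      have h2 := @IsLindelof.image X X t s A id h1 (continuous_id_iff_le.mpr hts)
      rwa [Set.image_id] at h2
    have := isLindelof_iff_lindelofSpace.mp hA
    infer_instance
  exact {}

lemma t5Space_lineTopology (hv : IndependentWithOne v) (hS : S.Nontrivial) (hw : Continuous w) :
    @T5Space ℝ (lineTopology v S w) := by
  refine t5Space_of_le (t := inferInstance) (fun U hU => isOpen_of_lineTopology hw hU)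
    inferInstance (t3Space_induced (lineMap_injective hv hS))

lemma lineTopology_mem (hv : IndependentWithOne v) (hS : S.Nontrivial) (hw : Continuous w) :
    lineTopology v S w ∈ coarseHausdorffTopologies :=
  ⟨fun _ hU => isOpen_of_lineTopology hw hU, by
    have := t5Space_lineTopology hv hS hw
    let _ := lineTopology v S w
    infer_instance⟩

end Line

lemma induced_eq_generateFrom_countableBasis {X Y : Type*} [tY : TopologicalSpace Y]
    [SecondCountableTopology Y] (g : X → Y) :
    TopologicalSpace.induced g tY = TopologicalSpace.generateFrom
      (Set.preimage g '' TopologicalSpace.countableBasis Y) := by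
  rw [← induced_generateFrom_eq]
  exact congrArg _ (TopologicalSpace.isBasis_countableBasis Y).eq_generateFrom

/-! ### Recurrence at both ends, category and weight -/

section Recurrence

variable {J : Type*} {v : J → ℝ} {S : Set J} {w : ℝ → ℝ} {f : C(UnitAddCircle, ℝ)}

/-- Every point is an accumulation point of the positive end of the line. -/
lemma exists_ge_mem_of_mem_nhds (hv : IndependentWithOne v) (hf : f 0 = 0) {x : ℝ} {U : Set ℝ}
    (hU : U ∈ @nhds ℝ (lineTopology v S (rightPart f)) x) (T : ℝ) : ∃ t, T ≤ t ∧ t ∈ U := by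
  obtain ⟨F, -, O, hO, V, hV, h⟩ := mem_nhds_lineTopology hU
  -- A circle point where f takes the value w x. The coordinate `none`, of frequency 1, steers t mod
  -- 1 towards it, which is where independence from 1 is needed.
  set c : UnitAddCircle := if 0 ≤ x then (x : UnitAddCircle) else 0 with hc
  have hfc : f c = rightPart f x := by
    by_cases hx : 0 ≤ x
    · rw [hc, if_pos hx, rightPart_of_nonneg f hx]
    · rw [hc, if_neg hx, rightPart_of_neg f (not_le.mp hx), hf]
  have hfV : f ⁻¹' V ∈ 𝓝 c := f.continuous.continuousAt.preimage_mem_nhds (by rwa [hfc])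
  obtain ⟨t, ht, htO⟩ := kronecker_atTop hv F.insertNone
    (O := fun o => o.elim (f ⁻¹' V) O)
    (β := fun o => o.elim c fun j => ((v j * x : ℝ) : UnitAddCircle))
    (by rintro (_ | j) -
        · exact hfV
        · exact hO j) (max T 0)
  refine ⟨t, (le_max_left _ _).trans ht, h t (fun j hj => ?_) ?_⟩
  · exact htO (some j) (by simpa using hj)
  · have := htO none (by simp)
    simp only [Option.elim_none, one_mul] at this
    rw [rightPart_of_nonneg f ((le_max_right _ _).trans ht)]
    exact this

/-- A neighbourhood of a zero of `rightPart f` depends on finitely many coordinates only: along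
the negative end of the line it contains points whose other coordinates are arbitrary. -/
lemma exists_finset_of_mem_nhds (hv : IndependentWithOne v) {x : ℝ} (hx : rightPart f x = 0)
    {U : Set ℝ} (hU : U ∈ @nhds ℝ (lineTopology v S (rightPart f)) x) :
    ∃ F : Finset J, (F : Set J) ⊆ S ∧ ∀ b ∉ F, ∀ (β : UnitAddCircle), ∀ O ∈ 𝓝 β, ∀ T : ℝ,
      ∃ t, t ≤ T ∧ t ∈ U ∧ ((v b * t : ℝ) : UnitAddCircle) ∈ O := by
  classical
  obtain ⟨F, hFS, O, hO, V, hV, h⟩ := mem_nhds_lineTopology hU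
  refine ⟨F, hFS, fun b hb β A hA T => ?_⟩
  -- The bound -1 makes t negative, so the real coordinate is 0 and only the circle coordinates need
  -- steering.
  obtain ⟨t, ht, htO⟩ := kronecker_atBot hv.linearIndependent (insert b F)
    (O := Function.update O b A)
    (β := Function.update (fun j => ((v j * x : ℝ) : UnitAddCircle)) b β)
    (by intro i _
        by_cases hi : i = b
        · subst hi; simpa using hA
        · simpa [hi] using hO i) (min T (-1))
  refine ⟨t, ht.trans (min_le_left _ _), h t (fun j hj => ?_) ?_, ?_⟩
  · have hjb : j ≠ b := fun e => hb (e ▸ hj)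
    simpa [hjb] using htO j (Finset.mem_insert_of_mem hj)
  · have : t < 0 := by
      have := ht.trans (min_le_right _ _)
      linarith
    rw [rightPart_of_neg f this]
    rw [hx] at hV
    exact mem_of_mem_nhds hV
  · simpa using htO b (Finset.mem_insert_self b F)

lemma exists_le_mem_of_mem_nhds [Infinite J] (hv : IndependentWithOne v) {x : ℝ}
    (hx : rightPart f x = 0) {U : Set ℝ}
    (hU : U ∈ @nhds ℝ (lineTopology v S (rightPart f)) x) (T : ℝ) : ∃ t, t ≤ T ∧ t ∈ U := by
  obtain ⟨F, -, h⟩ := exists_finset_of_mem_nhds hv hx hU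
  obtain ⟨b, hb⟩ := Infinite.exists_notMem_finset F
  obtain ⟨t, ht, htU, -⟩ := h b hb 0 Set.univ univ_mem T
  exact ⟨t, ht, htU⟩

/-- The intervals [-n, n] stay compact, hence closed, and have empty interior since every
neighbourhood is unbounded to the right. -/
lemma isFirstCategorySpace_lineTopology (hv : IndependentWithOne v) (hS : S.Nontrivial)
    (hf : f 0 = 0) : IsFirstCategorySpace (lineTopology v S (rightPart f)) := by
  set w := rightPart f
  have hw : Continuous w := continuous_rightPart hf
  have hT5 := t5Space_lineTopology hv hS hw
  have hnd : ∀ n : ℕ, @IsNowhereDense ℝ (lineTopology v S w) (Set.Icc (-n : ℝ) n) := by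
    intro n
    have hK : @IsCompact ℝ (lineTopology v S w) (Set.Icc (-n : ℝ) n) := by
      have h1 : IsCompact (Set.Icc (-n : ℝ) n) := isCompact_Icc
      have h2 := @IsCompact.image ℝ ℝ _ (lineTopology v S w) _ id h1
        (continuous_id_iff_le.mpr fun U hU => isOpen_of_lineTopology hw hU)
      rwa [Set.image_id] at h2
    have hcl : @IsClosed ℝ (lineTopology v S w) (Set.Icc (-n : ℝ) n) := by
      let _ := lineTopology v S w
      exact hK.isClosed
    refine (@IsClosed.isNowhereDense_iff ℝ (lineTopology v S w) _ hcl).mpr ?_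
    rw [Set.eq_empty_iff_forall_notMem]
    intro x hx
    have hx' := (@mem_interior_iff_mem_nhds ℝ (lineTopology v S w) _ _).mp hx
    obtain ⟨t, ht, htn⟩ := exists_ge_mem_of_mem_nhds hv hf hx' (n + 1)
    have := htn.2
    linarith
  refine ⟨fun n => Set.Icc (-n : ℝ) n, hnd, Set.eq_univ_of_forall fun x => ?_⟩
  obtain ⟨n, hn⟩ := exists_nat_ge |x|
  exact Set.mem_iUnion.mpr ⟨n, abs_le.mp hn⟩

lemma exists_mem_nhds_coe_disjoint (x : UnitAddCircle) :
    ∃ A ∈ 𝓝 x, ∃ β, ∃ B ∈ 𝓝 β, Disjoint A B := by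
  obtain ⟨β, hβ⟩ : ∃ β, β ≠ x := by
    refine ⟨x + ((1 / 2 : ℝ) : UnitAddCircle), fun h => ?_⟩
    obtain ⟨n, hn⟩ := exists_int_of_coe_eq_coe (x := 1 / 2) (y := 0) (by simpa using h)
    have h2 : ((2 * n : ℤ) : ℝ) = 1 := by
      push_cast
      rw [← hn]
      norm_num
    have h3 : 2 * n = 1 := by exact_mod_cast h2
    omega
  obtain ⟨A, B, hA, hB, hxA, hβB, h⟩ := t2_separation hβ.symm
  exact ⟨A, hA.mem_nhds hxA, β, B, hB.mem_nhds hβB, h⟩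

/-- A coordinate function not listed in `S` is not continuous for `lineTopology`. -/
lemma mem_of_forall_preimage_mem_nhds (hv : IndependentWithOne v) {b : J}
    (h : ∀ A ∈ 𝓝 ((v b * (-1) : ℝ) : UnitAddCircle),
      (fun t : ℝ => ((v b * t : ℝ) : UnitAddCircle)) ⁻¹' A ∈
        @nhds ℝ (lineTopology v S (rightPart f)) (-1)) : b ∈ S := by
  by_contra hb
  obtain ⟨A, hA, β, B, hB, hAB⟩ := exists_mem_nhds_coe_disjoint ((v b * (-1) : ℝ) : UnitAddCircle)
  obtain ⟨F, hF, hF'⟩ := exists_finset_of_mem_nhds hv (rightPart_of_neg f (by norm_num)) (h A hA)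
  obtain ⟨t, -, htA, htB⟩ := hF' b (fun hbF => hb (hF hbF)) β B hB 0
  exact Set.disjoint_left.mp hAB htA htB

lemma lineTopology_preimage_mem_nhds {b : J} (hb : b ∈ S) (x : ℝ) {A : Set UnitAddCircle}
    (hA : A ∈ 𝓝 ((v b * x : ℝ) : UnitAddCircle)) :
    (fun t : ℝ => ((v b * t : ℝ) : UnitAddCircle)) ⁻¹' A ∈ @nhds ℝ (lineTopology v S w) x := by
  have h := lineTopology_continuous_coord (v := v) (w := w) hb
  exact (@Continuous.tendsto ℝ UnitAddCircle (lineTopology v S w) _ _ h x) hA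

/-- S is recovered as the set of coordinates continuous at -1, a point where w vanishes. -/
lemma lineTopology_injective (hv : IndependentWithOne v) :
    Function.Injective fun S : Set J => lineTopology v S (rightPart f) := by
  have key : ∀ S S' : Set J, lineTopology v S (rightPart f) = lineTopology v S' (rightPart f) →
      S ⊆ S' := fun S S' h b hb => mem_of_forall_preimage_mem_nhds hv (f := f) fun A hA =>
        h ▸ lineTopology_preimage_mem_nhds hb (-1) hA
  exact fun S S' h => (key S S' h).antisymm (key S' S h.symm)

/-- A basic set around -1 restricts only finitely many coordinates, while each b ∈ S is restricted
by some basic set; so S is a union of at most |B| finite sets. -/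
lemma le_mk_of_isTopologicalBasis {J : Type} {v : J → ℝ} {S : Set J} (hv : IndependentWithOne v)
    (hS : S.Infinite) {B : Set (Set ℝ)}
    (hB : @TopologicalSpace.IsTopologicalBasis ℝ (lineTopology v S (rightPart f)) B) :
    #S ≤ #B := by
  have hF : ∀ U : B, ∃ F : Finset J, (-1 : ℝ) ∈ (U : Set ℝ) →
      ∀ b ∉ F, ∀ (β : UnitAddCircle), ∀ O ∈ 𝓝 β, ∃ t ∈ (U : Set ℝ),
        ((v b * t : ℝ) : UnitAddCircle) ∈ O := by
    intro U
    by_cases hU : (-1 : ℝ) ∈ (U : Set ℝ)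
    · have hUn : (U : Set ℝ) ∈ @nhds ℝ (lineTopology v S (rightPart f)) (-1) :=
        @TopologicalSpace.IsTopologicalBasis.mem_nhds ℝ (lineTopology v S (rightPart f)) _ _ _
          hB U.2 hU
      obtain ⟨F, -, h⟩ := exists_finset_of_mem_nhds hv (rightPart_of_neg f (by norm_num)) hUn
      refine ⟨F, fun _ b hb β O hO => ?_⟩
      obtain ⟨t, -, ht, htO⟩ := h b hb β O hO 0
      exact ⟨t, ht, htO⟩
    · exact ⟨∅, fun h => absurd h hU⟩
  choose F hF using hF
  have hsub : S ⊆ ⋃ U : B, (F U : Set J) := by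
    intro b hb
    obtain ⟨A, hA, β, O, hO, hAO⟩ :=
      exists_mem_nhds_coe_disjoint ((v b * (-1) : ℝ) : UnitAddCircle)
    obtain ⟨U, hUB, hU, hUA⟩ :=
      (@TopologicalSpace.IsTopologicalBasis.mem_nhds_iff ℝ (lineTopology v S (rightPart f))
        _ _ _ hB).mp (lineTopology_preimage_mem_nhds (w := rightPart f) hb (-1) hA)
    refine Set.mem_iUnion.mpr ⟨⟨U, hUB⟩, ?_⟩
    by_contra hbF
    obtain ⟨t, ht, htO⟩ := hF ⟨U, hUB⟩ hU b hbF β O hO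
    exact Set.disjoint_left.mp hAO (hUA ht) htO
  have hBinf : ℵ₀ ≤ #B := by
    by_contra! hlt
    have : Finite B := Cardinal.lt_aleph0_iff_finite.mp hlt
    exact hS ((Set.finite_iUnion fun U => (F U).finite_toSet).subset hsub)
  have hle : #(⋃ U : B, (F U : Set J)) ≤ #B * ℵ₀ := by
    refine (Cardinal.mk_iUnion_le fun U : B => (F U : Set J)).trans ?_
    gcongr
    exact ciSup_le' fun U => (Cardinal.lt_aleph0_of_finite _).le
  exact (Cardinal.mk_le_mk_of_subset hsub).trans (hle.trans (Cardinal.mul_aleph0_eq hBinf).le)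

/-- Countable bases pulled back along the coordinates form a subbasis of size at most |S|; its
finite intersections are indexed by lists. -/
lemma exists_isTopologicalBasis_le {J : Type} {v : J → ℝ} {S : Set J} (hS : S.Infinite) :
    ∃ B : Set (Set ℝ), @TopologicalSpace.IsTopologicalBasis ℝ (lineTopology v S w) B ∧
      #B ≤ #S := by
  have hSinf : Infinite S := hS.to_subtype
  set χ : S → ℝ → UnitAddCircle := fun j t => ((v j * t : ℝ) : UnitAddCircle)
  let C := TopologicalSpace.countableBasis UnitAddCircle
  let E := TopologicalSpace.countableBasis ℝ
  set G : Set (Set ℝ) := (⋃ j : S, Set.preimage (χ j) '' C) ∪ Set.preimage w '' E with hG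
  have hgen : lineTopology v S w = TopologicalSpace.generateFrom G := by
    have h1 : lineTopology v S w =
        (⨅ j : S, TopologicalSpace.induced (χ j) inferInstance) ⊓
          TopologicalSpace.induced w inferInstance := by
      rw [lineTopology, instTopologicalSpaceProd, induced_inf, induced_compose, induced_compose,
        Pi.topologicalSpace, induced_iInf]
      simp only [induced_compose]
      rfl
    rw [h1, hG, generateFrom_union, generateFrom_iUnion]
    simp only [C, E, ← induced_eq_generateFrom_countableBasis]
  have hGc : #G ≤ #S := by
    refine (Cardinal.mk_union_le _ _).trans ?_
    have a0 : ℵ₀ ≤ #S := Cardinal.aleph0_le_mk S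
    refine Cardinal.add_le_of_le a0 ?_ ?_
    · refine (Cardinal.mk_iUnion_le _).trans ?_
      refine (mul_le_mul_right (ciSup_le' (a := ℵ₀) fun j => ?_) _).trans
        (Cardinal.mul_aleph0_eq a0).le
      exact ((TopologicalSpace.countable_countableBasis _).image _).le_aleph0
    · exact (((TopologicalSpace.countable_countableBasis _).image _).le_aleph0).trans a0
  refine ⟨_, @TopologicalSpace.isTopologicalBasis_of_subbasis ℝ (lineTopology v S w) G hgen, ?_⟩
  have hsub : (fun A : Set (Set ℝ) => ⋂₀ A) '' {A | A.Finite ∧ A ⊆ G} ⊆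
      Set.range fun l : List G => ⋂₀ {U | ∃ g ∈ l, (g : Set ℝ) = U} := by
    rintro _ ⟨A, ⟨hA, hAG⟩, rfl⟩
    refine ⟨hA.toFinset.attach.toList.map
      fun U => ⟨U.1, hAG (hA.mem_toFinset.mp U.2)⟩, ?_⟩
    simp only
    congr 1
    ext U
    simpa using fun hU => hAG hU
  refine (Cardinal.mk_le_mk_of_subset hsub).trans (Cardinal.mk_range_le.trans ?_)
  exact (Cardinal.mk_list_le_max _).trans (max_le (Cardinal.aleph0_le_mk S) hGc)

lemma topologicalWeight_lineTopology {J : Type} {v : J → ℝ} {S : Set J}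
    (hv : IndependentWithOne v) (hS : S.Infinite) :
    topologicalWeight (lineTopology v S (rightPart f)) = #S := by
  obtain ⟨B, hB, hBS⟩ := exists_isTopologicalBasis_le (w := rightPart f) (v := v) hS
  refine le_antisymm ((csInf_le' (Set.mem_ofPred.mpr ⟨B, hB, rfl⟩)).trans hBS) ?_
  refine le_csInf ⟨_, B, hB, rfl⟩ ?_
  rintro _ ⟨B', hB', rfl⟩
  exact le_mk_of_isTopologicalBasis hv hS hB'

end Recurrence

/-! ### Homeomorphisms as order isomorphisms -/

section LimitSet

variable {J : Type*} {v : J → ℝ} {S S' : Set J} {f f' : C(UnitAddCircle, ℝ)}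

/-- The zeros of `rightPart f` are the accumulation points of the negative end of the line. -/
lemma rightPart_eq_zero_iff [Infinite J] (hv : IndependentWithOne v) {x : ℝ} :
    rightPart f x = 0 ↔ ∀ U ∈ @nhds ℝ (lineTopology v S (rightPart f)) x, ∀ T : ℝ,
      ∃ t, t ≤ T ∧ t ∈ U := by
  refine ⟨fun hx U hU T => exists_le_mem_of_mem_nhds hv hx hU T, fun h => ?_⟩
  by_contra hx
  have hc := lineTopology_continuous_snd (v := v) (S := S) (w := rightPart f)
  -- The set where w ≠ 0 is an open neighbourhood of x missing the negative half-line.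
  have hU := (@Continuous.tendsto ℝ ℝ (lineTopology v S (rightPart f)) _ _ hc x)
    (isOpen_compl_singleton.mem_nhds hx)
  obtain ⟨t, ht, htU⟩ := h _ hU (-1)
  exact htU (rightPart_of_neg f (by linarith))

lemma continuous_of_continuous_lineTopology_lineTopology (hv : IndependentWithOne v)
    (hS' : S'.Nontrivial) (hf : f 0 = 0) {h : ℝ → ℝ}
    (hc : Continuous[lineTopology v S (rightPart f), lineTopology v S' (rightPart f')] h) :
    Continuous h := by
  refine continuous_of_continuous_lineTopology (w := rightPart f') hv hS' ?_
  have h1 : @Continuous ℝ ℝ _ (lineTopology v S (rightPart f)) id :=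
    continuous_id_iff_le.mpr fun U hU => isOpen_of_lineTopology (continuous_rightPart hf) hU
  exact @Continuous.comp ℝ ℝ ℝ _ (lineTopology v S (rightPart f))
    (lineTopology v S' (rightPart f')) id h hc h1

lemma preimage_mem_nhds_of_continuous {X Y : Type*} {t : TopologicalSpace X}
    {s : TopologicalSpace Y} {h : X → Y} (hc : Continuous h) {x : X} {U : Set Y}
    (hU : U ∈ 𝓝 (h x)) : h ⁻¹' U ∈ 𝓝 x :=
  hc.continuousAt.preimage_mem_nhds hU

lemma rightPart_eq_zero_of_strictMono [Infinite J] (hv : IndependentWithOne v) {h : ℝ ≃ ℝ}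
    (hc : Continuous[lineTopology v S (rightPart f), lineTopology v S' (rightPart f')] h)
    (hmono : StrictMono h) {x : ℝ} (hx : rightPart f x = 0) : rightPart f' (h x) = 0 := by
  rw [rightPart_eq_zero_iff (S := S) hv] at hx
  rw [rightPart_eq_zero_iff (S := S') hv]
  intro U hU T
  obtain ⟨t, ht, htU⟩ := hx _ (preimage_mem_nhds_of_continuous hc hU) (h.symm T)
  refine ⟨h t, ?_, htU⟩
  have := hmono.monotone ht
  rwa [Equiv.apply_symm_apply] at this

/-- A homeomorphism between two of the spaces is an order isomorphism preserving the set of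
accumulation points of the negative end. -/
lemma exists_orderIso_of_homeomorph [Infinite J] (hv : IndependentWithOne v)
    (hS' : S'.Nontrivial) (hf : f 0 = 0)
    (hne : ∃ y, rightPart f' y ≠ 0) {h : ℝ ≃ ℝ}
    (hc : Continuous[lineTopology v S (rightPart f), lineTopology v S' (rightPart f')] h)
    (hc' : Continuous[lineTopology v S' (rightPart f'), lineTopology v S (rightPart f)] h.symm) :
    ∃ e : ℝ ≃o ℝ, ∀ x, rightPart f' (e x) = 0 ↔ rightPart f x = 0 := by
  have hcont := continuous_of_continuous_lineTopology_lineTopology hv hS' hf hc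
  rcases hcont.strictMono_of_inj h.injective with hm | hm
  · have hm' : StrictMono h.symm := by
      intro a b hab
      rw [← hm.lt_iff_lt]
      simpa using hab
    refine ⟨hm.orderIsoOfSurjective h h.surjective, fun x => ⟨fun hx => ?_, fun hx => ?_⟩⟩
    · have := rightPart_eq_zero_of_strictMono hv hc' hm' hx
      simpa using this
    · exact rightPart_eq_zero_of_strictMono hv hc hm hx
  -- A decreasing map swaps the ends. Every point is accumulated by the positive end of the source,
  -- so every point of the target would be accumulated by the negative end, making w identically 0.
  · exfalso
    obtain ⟨y, hy⟩ := hne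
    refine hy ((rightPart_eq_zero_iff (S := S') hv).mpr fun U hU T => ?_)
    obtain ⟨x, rfl⟩ := h.surjective y
    obtain ⟨t, ht, htU⟩ := exists_ge_mem_of_mem_nhds hv hf
      (preimage_mem_nhds_of_continuous hc hU) (h.symm T)
    refine ⟨h t, ?_, htU⟩
    have := hm.antitone ht
    rwa [Equiv.apply_symm_apply] at this

end LimitSet

/-! ### Coding a set of naturals in the order type of a zero set -/

section Gaps

variable {D D' : Set ℕ}

/-- The left endpoints of the gaps. -/
noncomputable def gapLeft (n : ℕ) : ℝ := 1 - (1 / 2) ^ n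

open Classical in
/-- The right endpoints of the gaps. -/
noncomputable def gapRight (D : Set ℕ) (n : ℕ) : ℝ :=
  if n ∈ D then gapLeft (n + 1) else (gapLeft n + gapLeft (n + 1)) / 2

/-- The complement of the gaps. -/
def gapCompl (D : Set ℕ) : Set ℝ := {t | ∀ n, t ∉ Set.Ioo (gapLeft n) (gapRight D n)}

lemma gapLeft_zero : gapLeft 0 = 0 := by simp [gapLeft]

lemma gapLeft_strictMono : StrictMono gapLeft := by
  intro m n h
  have := pow_lt_pow_right_of_lt_one₀ (a := (1 / 2 : ℝ)) (by norm_num) (by norm_num) h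
  unfold gapLeft
  linarith

lemma gapLeft_nonneg (n : ℕ) : 0 ≤ gapLeft n :=
  gapLeft_zero ▸ gapLeft_strictMono.monotone n.zero_le

lemma gapLeft_lt_one (n : ℕ) : gapLeft n < 1 := by
  have : (0 : ℝ) < (1 / 2) ^ n := by positivity
  unfold gapLeft
  linarith

lemma gapLeft_lt_gapRight (D : Set ℕ) (n : ℕ) : gapLeft n < gapRight D n := by
  have := gapLeft_strictMono n.lt_succ_self
  unfold gapRight
  split_ifs <;> simp only [Nat.succ_eq_add_one] at this <;> linarith

lemma gapRight_le_gapLeft_succ (D : Set ℕ) (n : ℕ) : gapRight D n ≤ gapLeft (n + 1) := by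
  have := gapLeft_strictMono n.lt_succ_self
  unfold gapRight
  split_ifs <;> simp only [Nat.succ_eq_add_one] at this <;> linarith

/-- This decodes D: gap n abuts gap n + 1, sharing a single endpoint, or leaves an interval of zeros
between them. -/
lemma gapRight_eq_iff {n : ℕ} : gapRight D n = gapLeft (n + 1) ↔ n ∈ D := by
  have := gapLeft_strictMono n.lt_succ_self
  unfold gapRight
  split_ifs with h
  · simp [h]
  · simp only [Nat.succ_eq_add_one] at this
    simp only [h, iff_false]
    intro h'
    linarith

lemma isClosed_gapCompl (D : Set ℕ) : IsClosed (gapCompl D) := by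
  have : gapCompl D = (⋃ n, Set.Ioo (gapLeft n) (gapRight D n))ᶜ := by
    ext t; simp [gapCompl]
  rw [this]
  exact (isOpen_iUnion fun n => isOpen_Ioo).isClosed_compl

lemma mem_gapCompl_of_le {t : ℝ} {n : ℕ} (h1 : gapRight D n ≤ t) (h2 : t ≤ gapLeft (n + 1)) :
    t ∈ gapCompl D := by
  intro m ⟨hm1, hm2⟩
  rcases le_or_gt m n with h | h
  · rcases h.eq_or_lt with rfl | h
    · linarith
    · have := gapLeft_strictMono.monotone (Nat.succ_le_of_lt h)
      have h3 := gapRight_le_gapLeft_succ D m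
      have h4 := gapLeft_lt_gapRight D n
      simp only [Nat.succ_eq_add_one] at this
      linarith
  · have := gapLeft_strictMono.monotone (Nat.succ_le_of_lt h)
    simp only [Nat.succ_eq_add_one] at this
    linarith

lemma mem_gapCompl_of_nonpos {t : ℝ} (h : t ≤ 0) : t ∈ gapCompl D := fun n hn => by
  have := gapLeft_nonneg n
  have := hn.1
  linarith

lemma one_mem_gapCompl : (1 : ℝ) ∈ gapCompl D := fun n hn => by
  have := gapRight_le_gapLeft_succ D n
  have := gapLeft_lt_one (n + 1)
  have := hn.2
  linarith

/-- A continuous function on the circle vanishing exactly outside the gaps. -/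
noncomputable def gapFunction (D : Set ℕ) : C(UnitAddCircle, ℝ) where
  toFun := AddCircle.liftIco 1 0 fun t => Metric.infDist t (gapCompl D)
  continuous_toFun := AddCircle.liftIco_zero_continuous
    (by rw [Metric.infDist_zero_of_mem (mem_gapCompl_of_nonpos le_rfl),
          Metric.infDist_zero_of_mem one_mem_gapCompl])
    (Metric.continuous_infDist_pt _).continuousOn

lemma gapFunction_coe {t : ℝ} (h0 : 0 ≤ t) (h1 : t < 1) :
    gapFunction D (t : UnitAddCircle) = Metric.infDist t (gapCompl D) :=
  AddCircle.liftIco_zero_coe_apply (f := fun t => Metric.infDist t (gapCompl D)) ⟨h0, h1⟩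

lemma gapFunction_zero : gapFunction D 0 = 0 := by
  have := gapFunction_coe (D := D) le_rfl one_pos
  rwa [Metric.infDist_zero_of_mem (mem_gapCompl_of_nonpos le_rfl), AddCircle.coe_zero] at this

lemma rightPart_gapFunction_eq_zero_iff {t : ℝ} (h1 : t < 1) :
    rightPart (gapFunction D) t = 0 ↔ t ∈ gapCompl D := by
  rcases lt_or_ge t 0 with h | h
  · simp [rightPart_of_neg _ h, mem_gapCompl_of_nonpos h.le]
  · rw [rightPart_of_nonneg _ h, gapFunction_coe h h1,
      (isClosed_gapCompl D).mem_iff_infDist_zero ⟨0, mem_gapCompl_of_nonpos le_rfl⟩]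

lemma rightPart_gapFunction_ne_zero {t : ℝ} {n : ℕ} (h : t ∈ Set.Ioo (gapLeft n) (gapRight D n)) :
    rightPart (gapFunction D) t ≠ 0 := by
  have h1 : t < 1 := h.2.trans_le
    ((gapRight_le_gapLeft_succ D n).trans (gapLeft_lt_one (n + 1)).le)
  rw [Ne, rightPart_gapFunction_eq_zero_iff h1]
  exact fun h' => h' n h

lemma isGLB_of_Ioo_subset {A : Set ℝ} {a b : ℝ} (hab : a < b) (h : Set.Ioo a b ⊆ A)
    (hl : ∀ t ∈ A, a ≤ t) : IsGLB A a := by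
  refine ⟨hl, fun c hc => ?_⟩
  exact (isGLB_Ioo hab).2 fun t ht => hc (h ht)

/-- This and the next two lemmas obtain the endpoints successively from the order and the zero set
alone, so that an order isomorphism transports them. -/
lemma isGLB_nonzero_zero :
    IsGLB {t | rightPart (gapFunction D) t ≠ 0} (gapLeft 0) := by
  refine isGLB_of_Ioo_subset (gapLeft_lt_gapRight D 0)
    (fun t ht => rightPart_gapFunction_ne_zero ht) fun t ht => ?_
  by_contra! hlt
  rw [gapLeft_zero] at hlt
  exact ht (rightPart_of_neg _ hlt)

lemma isGLB_zeros_gapRight (n : ℕ) :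
    IsGLB {t | rightPart (gapFunction D) t = 0 ∧ gapLeft n < t} (gapRight D n) := by
  have hlt : gapRight D n < 1 :=
    (gapRight_le_gapLeft_succ D n).trans_lt (gapLeft_lt_one (n + 1))
  refine IsLeast.isGLB ⟨⟨?_, gapLeft_lt_gapRight D n⟩, fun t ht => ?_⟩
  · rw [rightPart_gapFunction_eq_zero_iff hlt]
    exact mem_gapCompl_of_le le_rfl (gapRight_le_gapLeft_succ D n)
  · by_contra! h
    exact rightPart_gapFunction_ne_zero ⟨ht.2, h⟩ ht.1

lemma isGLB_nonzero_gapLeft_succ (n : ℕ) :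
    IsGLB {t | rightPart (gapFunction D) t ≠ 0 ∧ gapRight D n < t} (gapLeft (n + 1)) := by
  refine isGLB_of_Ioo_subset (gapLeft_lt_gapRight D (n + 1)) (fun t ht =>
    ⟨rightPart_gapFunction_ne_zero ht, (gapRight_le_gapLeft_succ D n).trans_lt ht.1⟩)
    fun t ht => ?_
  by_contra! hlt
  refine ht.1 ((rightPart_gapFunction_eq_zero_iff (hlt.trans (gapLeft_lt_one _))).mpr ?_)
  exact mem_gapCompl_of_le ht.2.le hlt.le

lemma eq_of_orderIso {e : ℝ ≃o ℝ}
    (he : ∀ x, rightPart (gapFunction D') (e x) = 0 ↔ rightPart (gapFunction D) x = 0) :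
    D = D' := by
  have himage : ∀ P Q : ℝ → Prop, (∀ x, Q (e x) ↔ P x) → e '' {t | P t} = {t | Q t} := by
    intro P Q h
    ext t
    constructor
    · rintro ⟨x, hx, rfl⟩
      exact (h x).mpr hx
    · intro ht
      exact ⟨e.symm t, (h _).mp (by simpa using ht), by simp⟩
  have hright : ∀ n, e (gapLeft n) = gapLeft n → e (gapRight D n) = gapRight D' n := by
    intro n hn
    refine (e.isGLB_image'.mpr (isGLB_zeros_gapRight n)).unique ?_
    rw [himage _ (fun t => rightPart (gapFunction D') t = 0 ∧ gapLeft n < t)]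
    · exact isGLB_zeros_gapRight n
    · intro x
      nth_rw 1 [← hn]
      rw [he, e.lt_iff_lt]
  -- Left endpoints do not depend on D, so e fixes them all.
  have hleft : ∀ n, e (gapLeft n) = gapLeft n := by
    intro n
    induction n with
    | zero =>
      refine (e.isGLB_image'.mpr (isGLB_nonzero_zero (D := D))).unique ?_
      rw [himage _ (fun t => rightPart (gapFunction D') t ≠ 0) fun x => (he x).not]
      exact isGLB_nonzero_zero
    | succ n ih =>
      refine (e.isGLB_image'.mpr (isGLB_nonzero_gapLeft_succ (D := D) n)).unique ?_
      rw [himage _ (fun t => rightPart (gapFunction D') t ≠ 0 ∧ gapRight D' n < t)]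
      · exact isGLB_nonzero_gapLeft_succ n
      · intro x
        rw [← hright n ih, Ne, he, e.lt_iff_lt]
  ext n
  rw [← gapRight_eq_iff, ← gapRight_eq_iff, ← hright n (hleft n)]
  nth_rw 2 [← hleft (n + 1)]
  exact e.injective.eq_iff.symm

end Gaps

/-! ### Counting homeomorphism classes -/

lemma eq_of_continuous_of_eq_on_rat {Y : Type*} [TopologicalSpace Y] [T2Space Y] {g h : ℝ → Y}
    (hg : Continuous g) (hh : Continuous h) (hgh : ∀ q : ℚ, g q = h q) : g = h :=
  Rat.denseRange_cast.equalizer hg hh (funext hgh)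

lemma eq_induced_of_homeomorph {X Y : Type*} {t : TopologicalSpace X} {s : TopologicalSpace Y}
    (h : X ≃ₜ Y) : t = TopologicalSpace.induced h.toEquiv s :=
  h.isInducing.eq_induced

/-- Only continuum many coarser Hausdorff topologies on the line are homeomorphic to a given one,
so a family of more than continuum many of them contains an equally large subfamily of pairwise
non-homeomorphic members. -/
lemma exists_subset_pairwise_not_homeomorphic {A : Set (TopologicalSpace ℝ)}
    (hA : A ⊆ coarseHausdorffTopologies) (hc : 𝔠 < #A) :
    ∃ T ⊆ A, #T = #A ∧
      ∀ τ₁ ∈ T, ∀ τ₂ ∈ T, τ₁ ≠ τ₂ → IsEmpty (@Homeomorph ℝ ℝ τ₁ τ₂) := by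
  let s : Setoid A :=
    { r := fun a b => Nonempty (@Homeomorph ℝ ℝ a b)
      iseqv :=
        { refl := fun a => ⟨@Homeomorph.refl ℝ a⟩
          symm := fun {a b} ⟨h⟩ => ⟨@Homeomorph.symm ℝ ℝ a b h⟩
          trans := fun {a b c} ⟨h⟩ ⟨k⟩ => ⟨@Homeomorph.trans ℝ ℝ ℝ a b c h k⟩ } }
  have hout : ∀ a : A, ∃ g : ℝ → ℝ,
      @Continuous ℝ ℝ inferInstance ((⟦a⟧ : Quotient s).out : TopologicalSpace ℝ) g ∧
        (a : TopologicalSpace ℝ) = TopologicalSpace.induced g (⟦a⟧ : Quotient s).out := by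
    intro a
    obtain ⟨h⟩ := s.symm (Quotient.mk_out a)
    have h1 : @Continuous ℝ ℝ inferInstance a id :=
      continuous_id_iff_le.mpr fun U hU => (hA a.2).1 U hU
    refine ⟨@Homeomorph.toEquiv ℝ ℝ a (⟦a⟧ : Quotient s).out h, ?_,
      eq_induced_of_homeomorph h⟩
    exact @Continuous.comp ℝ ℝ ℝ _ a (⟦a⟧ : Quotient s).out id _
      (@Homeomorph.continuous_toFun ℝ ℝ a (⟦a⟧ : Quotient s).out h) h1
  choose g hcont hind using hout
  -- A topology is induced from its class representative by g, and g is Euclidean-continuous into a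
  -- Hausdorff space, so its values on ℚ determine it.
  have hinj : Function.Injective fun a : A => ((⟦a⟧ : Quotient s), fun q : ℚ => g a q) := by
    intro a b hab
    obtain ⟨h1, h2⟩ := Prod.mk.inj hab
    have hT2 : @T2Space ℝ ((⟦b⟧ : Quotient s).out : TopologicalSpace ℝ) :=
      (hA (⟦b⟧ : Quotient s).out.2).2
    have hga := hcont a
    rw [h1] at hga
    have hgab : g a = g b :=
      @eq_of_continuous_of_eq_on_rat ℝ (⟦b⟧ : Quotient s).out hT2 _ _ hga (hcont b) (congrFun h2)
    exact Subtype.ext (by rw [hind a, hind b, hgab, h1])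
  have hle : #A ≤ #(Quotient s) * 𝔠 := by
    have := Cardinal.mk_le_of_injective hinj
    rw [Cardinal.mk_prod, Cardinal.lift_id, Cardinal.lift_id] at this
    simpa [Cardinal.mk_real] using this
  have hQ : #(Quotient s) = #A := by
    refine le_antisymm Cardinal.mk_quotient_le ?_
    rcases le_total (#(Quotient s)) 𝔠 with hle' | hle'
    · exact absurd (hle.trans ((mul_le_mul_left hle' _).trans Cardinal.continuum_mul_self.le))
        hc.not_ge
    · exact hle.trans (Cardinal.mul_eq_left (Cardinal.aleph0_le_continuum.trans hle') hle'
        Cardinal.continuum_ne_zero).le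
  have hinj' : Function.Injective fun x : Quotient s => (x.out : TopologicalSpace ℝ) :=
    Subtype.val_injective.comp Quotient.out_injective
  refine ⟨Set.range fun x : Quotient s => (x.out : TopologicalSpace ℝ), ?_, ?_, ?_⟩
  · rintro _ ⟨x, rfl⟩
    exact x.out.2
  · rw [Cardinal.mk_range_eq _ hinj', hQ]
  · rintro _ ⟨x, rfl⟩ _ ⟨y, rfl⟩ hne
    refine ⟨fun k => hne ?_⟩
    have : x = y := by
      rw [← Quotient.out_eq x, ← Quotient.out_eq y]
      exact Quotient.sound ⟨k⟩
    rw [this]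

/-! ### Choice of frequencies and conclusion -/

/-- A Hamel basis of ℝ over ℚ has 𝔠 elements; dividing by one of them turns it into 1. -/
lemma exists_independentWithOne (J : Type) (hJ : #(Option J) ≤ 𝔠) :
    ∃ v : J → ℝ, IndependentWithOne v := by
  let b := Module.Basis.ofVectorSpace ℚ ℝ
  have hb : #(Module.Basis.ofVectorSpaceIndex ℚ ℝ) = 𝔠 := by
    rw [b.mk_eq_rank'', Real.rank_rat_real]
  obtain ⟨e⟩ : Nonempty (Option J ↪ Module.Basis.ofVectorSpaceIndex ℚ ℝ) :=
    (Cardinal.le_def _ _).mp (hJ.trans hb.ge)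
  have h0 : b (e none) ≠ 0 := b.ne_zero _
  refine ⟨fun j => (b (e none))⁻¹ * b (e (some j)), ?_⟩
  have h := (b.linearIndependent.comp e e.injective).map'
    (LinearMap.mulLeft ℚ (b (e none))⁻¹) (LinearMap.ker_eq_bot.mpr
      (mul_right_injective₀ (inv_ne_zero h0)))
  unfold IndependentWithOne
  have heq : (fun o : Option J => o.elim 1 fun j => (b (e none))⁻¹ * b (e (some j))) =
      LinearMap.mulLeft ℚ (b (e none))⁻¹ ∘ b ∘ e := by
    funext o
    cases o with
    | none => simp [h0]
    | some j => simp
  rw [heq]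
  exact h

theorem theorem11 (κ : Cardinal.{0}) (hκ : ℵ₀ ≤ κ) (hκc : κ ≤ 𝔠) :
    ∃ T : Set (TopologicalSpace ℝ),
      T ⊆ coarseHausdorffTopologies ∧
      #T = 2 ^ κ ∧
      (∀ τ ∈ T, @T5Space ℝ τ ∧ IsFirstCategorySpace τ ∧ topologicalWeight τ = κ) ∧
      (∀ τ₁ ∈ T, ∀ τ₂ ∈ T, τ₁ ≠ τ₂ → IsEmpty (@Homeomorph ℝ ℝ τ₁ τ₂)) := by
  obtain ⟨I, rfl⟩ : ∃ I : Type, #I = κ := ⟨κ.out, κ.mk_out⟩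
  have hI : Infinite I := Cardinal.aleph0_le_mk_iff.mp hκ
  have hJ : #(I ⊕ I) = #I := by
    rw [Cardinal.mk_sum, Cardinal.lift_id, Cardinal.add_eq_self hκ]
  obtain ⟨v, hv⟩ := exists_independentWithOne (I ⊕ I) (by
    rw [Cardinal.mk_option, hJ, Cardinal.add_one_eq hκ]
    exact hκc)
  -- The left copy of I forces cardinality κ whatever X is; the right copy records X.
  set S : Set I → Set (I ⊕ I) := fun X => Set.range Sum.inl ∪ Sum.inr '' X with hS
  have hSinj : Function.Injective S := by
    intro X Y hXY
    ext i
    have := congrArg (Sum.inr i ∈ ·) hXY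
    simpa [hS] using this
  have hScard : ∀ X, #(S X) = #I := by
    intro X
    refine le_antisymm ((Cardinal.mk_set_le _).trans hJ.le) ?_
    exact Cardinal.mk_le_of_injective (f := fun i => (⟨Sum.inl i, Or.inl ⟨i, rfl⟩⟩ : S X))
      fun i j hij => Sum.inl_injective (congrArg Subtype.val hij)
  have hSinf : ∀ X, (S X).Infinite := fun X => by
    rw [← Set.infinite_coe_iff, ← Cardinal.aleph0_le_mk_iff, hScard]
    exact hκ
  have hSnt : ∀ X, (S X).Nontrivial := fun X => (hSinf X).nontrivial
  set τ : Set I → Set ℕ → TopologicalSpace ℝ := fun X D =>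
    lineTopology v (S X) (rightPart (gapFunction D)) with hτ
  have hmem : ∀ X D, τ X D ∈ coarseHausdorffTopologies := fun X D =>
    lineTopology_mem hv (hSnt X) (continuous_rightPart gapFunction_zero)
  have hprop : ∀ X D, @T5Space ℝ (τ X D) ∧ IsFirstCategorySpace (τ X D) ∧
      topologicalWeight (τ X D) = #I := fun X D =>
    ⟨t5Space_lineTopology hv (hSnt X) (continuous_rightPart gapFunction_zero),
      isFirstCategorySpace_lineTopology hv (hSnt X) gapFunction_zero,
      (topologicalWeight_lineTopology hv (hSinf X)).trans (hScard X)⟩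
  -- Counting needs more than 𝔠 topologies. Otherwise 2^κ = 𝔠 and subsets D of ℕ suffice, with X = ∅
  -- fixed.
  rcases le_or_gt ((2 : Cardinal) ^ #I) 𝔠 with hle | hlt
  · have hcard : (2 : Cardinal) ^ #I = 𝔠 := by
      refine le_antisymm hle ?_
      rw [← Cardinal.two_power_aleph0]
      exact Cardinal.power_le_power_left two_ne_zero hκ
    have hdist : ∀ D D', Nonempty (@Homeomorph ℝ ℝ (τ ∅ D) (τ ∅ D')) → D = D' := by
      rintro D D' ⟨h⟩
      obtain ⟨y, hy⟩ := exists_between (gapLeft_lt_gapRight D' 0)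
      obtain ⟨e, he⟩ := exists_orderIso_of_homeomorph hv (hSnt ∅) gapFunction_zero
        ⟨y, rightPart_gapFunction_ne_zero hy⟩
        (@Homeomorph.continuous_toFun ℝ ℝ (τ ∅ D) (τ ∅ D') h)
        (@Homeomorph.continuous_invFun ℝ ℝ (τ ∅ D) (τ ∅ D') h)
      exact eq_of_orderIso he
    have hinj : Function.Injective (τ ∅) := fun D D' h =>
      hdist D D' (h ▸ ⟨@Homeomorph.refl ℝ (τ ∅ D)⟩)
    refine ⟨Set.range (τ ∅), ?_, ?_, ?_, ?_⟩
    · rintro _ ⟨D, rfl⟩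
      exact hmem ∅ D
    · rw [Cardinal.mk_range_eq _ hinj, hcard]
      simp
    · rintro _ ⟨D, rfl⟩
      exact hprop ∅ D
    · rintro _ ⟨D, rfl⟩ _ ⟨D', rfl⟩ hne
      exact ⟨fun h => hne (congrArg _ (hdist D D' ⟨h⟩))⟩
  · have hinj : Function.Injective fun X => τ X ∅ :=
      (lineTopology_injective hv).comp hSinj
    have hcard : #(Set.range fun X => τ X ∅) = 2 ^ #I := by
      rw [Cardinal.mk_range_eq _ hinj, Cardinal.mk_set]
    obtain ⟨T, hTA, hT, hTn⟩ := exists_subset_pairwise_not_homeomorphic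
      (A := Set.range fun X => τ X ∅) (by rintro _ ⟨X, rfl⟩; exact hmem X ∅) (hcard ▸ hlt)
    refine ⟨T, fun t ht => ?_, hT.trans hcard, fun t ht => ?_, hTn⟩
    · obtain ⟨X, rfl⟩ := hTA ht
      exact hmem X ∅
    · obtain ⟨X, rfl⟩ := hTA ht
      exact hprop X ∅
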